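/- Let $d\ge 2$ and let $F=(F_1,\dots,F_d):\mathbb{R}^d\to\mathbb{R}^d$ be a vector field all of whose components are Schwartz functions; let $\Phi=\operatorname{div}F$. For $(\omega,p)\in\mathbb{S}^{d-1}\times\mathbb{R}$ let $\Pi(\omega,p)=\{x:\omega\cdot x=p\}$, let $[\mathcal{R}f](\omega,p)=\int_{\Pi(\omega,p)}f\,dA$ be the Radon transform, and put $\mathfrak{R}F=(\mathcal{R}F_1,\dots,\mathcal{R}F_d)$ and $[\mathcal{D}^\perp F](\omega,p)=\int_{\Pi(\omega,p)}\omega\cdot F\,dA$. For every $\omega\in\mathbb{S}^{d-1}$ let $\omega_1,\dots,\omega_{d-1}$ (depending on $\omega$ in an arbitrary way) be such that $(\omega,\omega_1,\dots,\omega_{d-1})$ is an orthonormal basis of $\mathbb{R}^d$, and let $[\mathcal{W}_k^\perp F](\omega,p)=\int_{\Pi(\omega,p)}(\omega_k\cdot x)\,F(x)\cdot\omega\,dA(x)$. For a function $g$ on $\mathbb{S}^{d-1}\times\mathbb{R}$ and a real number $\alpha<d$ let $$\mathcal{R}^{-1}g=\tfrac12(2\pi)^{1-d}I^{-\alpha}\mathcal{R}^{\#}I^{\alpha-d+1}g,\qquad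 [\mathcal{R}^{\#}g](x)=\int_{\mathbb{S}^{d-1}}g(\omega,\omega\cdot x)\,d\omega,\qquad I^{a}u=\mathcal{F}^{-1}\big(|\xi|^{-a}\mathcal{F}u\big),$$ where $I^{\alpha-d+1}$ acts in the variable $p$, $\mathcal{F}$ is the Fourier transform with kernel $e^{-ix\cdot\xi}$, and $\mathcal{F}u$ is taken in the sense of tempered distributions and is required to be a function. Then all the transforms below exist, $\mathcal{D}^\perp F$ and $\mathcal{W}_k^\perp F$ are differentiable in $p$, and the following holds. 1. For every $\alpha<d$, every operation in $\mathcal{R}^{-1}(\partial_p\mathcal{D}^\perp F)$ is well defined, and $\Phi(x)=\big[\mathcal{R}^{-1}(\partial_p\mathcal{D}^\perp F)\big](x)$ for all $x\in\mathbb{R}^d$. 2. For all $(\omega,p)\in\mathbb{S}^{d-1}\times\mathbb{R}$, $$[\mathfrak{R}F](\omega,p)=\omega\,[\mathcal{D}^\perp F](\omega,p)+\sum_{k=1}^{d-1}\omega_k\Big(\partial_p[\mathcal{W}_k^\perp F](\omega,p)-[\mathcal{R}\{(\omega_k\cdot x)\Phi(x)\}](\omega,p)\Big).$$ 3. For every $\alpha<d$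 and every $j=1,\dots,d$, every operation in $\mathcal{R}^{-1}(e_j\cdot\mathfrak{R}F)$ is well defined, and $F_j(x)=\big[\mathcal{R}^{-1}(e_j\cdot\mathfrak{R}F)\big](x)$ for all $x\in\mathbb{R}^d$, where $e_1,\dots,e_d$ is the canonical basis of $\mathbb{R}^d$. -/

import Mathlib

open MeasureTheory Metric
open scoped SchwartzMap FourierTransform

namespace VectorRadon

noncomputable section

/-- The Euclidean space `ℝ^d`. -/
abbrev E (d : ℕ) : Type := EuclideanSpace ℝ (Fin d)

/-- The unit sphere `S^{d-1}` in `ℝ^d`. -/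
abbrev S (d : ℕ) : Type := sphere (0 : E d) 1

/-! ### Radon transforms

The hyperplane `Π(ω,p) = {x | ω · x = p}` is the image of the linear hyperplane `ω^⊥` under the
isometry `y ↦ p ω + y`, so that the area element of `Π(ω,p)` is the `(d-1)`-dimensional Lebesgue
measure of the Euclidean space `ω^⊥`. -/

/-- The integral of `f` over the hyperplane `Π(ω,p)` converges absolutely. -/
def RadonIntegrable {d : ℕ} (f : E d → ℝ) (ω : S d) (p : ℝ) : Prop :=
  Integrable (fun y : (Submodule.span ℝ {(ω : E d)})ᗮ => f (p • (ω : E d) + (y : E d))) volume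

/-- The Radon transform `[R f](ω, p) = ∫_{Π(ω,p)} f dA`. -/
def radon {d : ℕ} (f : E d → ℝ) (ω : S d) (p : ℝ) : ℝ :=
  ∫ y : (Submodule.span ℝ {(ω : E d)})ᗮ, f (p • (ω : E d) + (y : E d))

/-- The divergence `∑ⱼ ∂Fⱼ/∂xⱼ` of a vector field. -/
def divergence {d : ℕ} (F : E d → E d) (x : E d) : ℝ :=
  ∑ j : Fin d, (fderiv ℝ F x (EuclideanSpace.single j 1)) j

/-- The componentwise Radon transform `(R F₁, …, R F_d)`. -/
def radonVec {d : ℕ} (F : E d → E d) (ω : S d) (p : ℝ) : E d :=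
  WithLp.toLp 2 (fun j => radon (fun x => F x j) ω p)

/-- The transversal Radon transform `[D^⊥ F](ω, p) = ∫_{Π(ω,p)} ω · F(x) dA(x)`. -/
def transversal {d : ℕ} (F : E d → E d) (ω : S d) (p : ℝ) : ℝ :=
  radon (fun x => inner ℝ (ω : E d) (F x)) ω p

/-- A choice, for every direction `ω`, of vectors `ω₁(ω), …, ω_{d-1}(ω)` such that
`(ω, ω₁, …, ω_{d-1})` is an orthonormal basis of `ℝ^d`. No regularity in `ω` is required. -/
def IsAdaptedFrame {d : ℕ} (b : S d → Fin (d - 1) → E d) : Prop :=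
  ∀ ω : S d, Orthonormal ℝ (b ω) ∧ ∀ k, inner ℝ (ω : E d) (b ω k) = 0

/-- The transversal transform with the linear weight `ω_k · x`:
`[W_k^⊥ F](ω, p) = ∫_{Π(ω,p)} (ω_k · x) F(x) · ω dA(x)`, where `ω_k = b ω k`. -/
def weightedTransversal {d : ℕ} (b : S d → Fin (d - 1) → E d) (k : Fin (d - 1))
    (F : E d → E d) (ω : S d) (p : ℝ) : ℝ :=
  radon (fun x => inner ℝ (b ω k) x * inner ℝ (F x) (ω : E d)) ω p

/-! ### Riesz potentials -/

section Riesz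

variable {V : Type*} [NormedAddCommGroup V] [InnerProductSpace ℝ V] [FiniteDimensional ℝ V]
  [MeasurableSpace V] [BorelSpace V]

/-- The tempered distribution `T` is given by the function `u`. -/
def IsGivenBy (T : 𝓢'(V, ℂ)) (u : V → ℂ) : Prop :=
  LocallyIntegrable u volume ∧
    ∀ ψ : 𝓢(V, ℂ), Integrable (fun x => ψ x * u x) volume ∧ T ψ = ∫ x, ψ x * u x

/-- The function `v` is the Fourier transform of the function `u`, in the sense of tempered
distributions. The kernel is Mathlib's `exp (-2πi x·ξ)`. -/
def IsFourierOf (u v : V → ℂ) : Prop :=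
  ∃ T : 𝓢'(V, ℂ), IsGivenBy T u ∧ IsGivenBy (𝓕 T) v

/-- The Fourier transform of a function is unique up to null sets. -/
theorem IsFourierOf.ae_eq {u v w : V → ℂ} (h1 : IsFourierOf u v) (h2 : IsFourierOf u w) :
    v =ᵐ[volume] w := by
  obtain ⟨T, hT, hv⟩ := h1
  obtain ⟨T', hT', hw⟩ := h2
  have hTT : T = T' := by ext ψ; rw [(hT.2 ψ).2, (hT'.2 ψ).2]
  subst hTT
  apply ae_eq_of_integral_contDiff_smul_eq hv.1 hw.1
  intro g hg hc
  have hg' : ContDiff ℝ ((⊤ : ℕ∞) : WithTop ℕ∞) (fun x => (g x : ℂ)) :=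
    Complex.ofRealCLM.contDiff.comp hg
  have hc' : HasCompactSupport (fun x => (g x : ℂ)) :=
    hc.comp_left (g := fun r : ℝ => (r : ℂ)) (by simp)
  have e1 := (hv.2 (hc'.toSchwartzMap hg')).2
  have e2 := (hw.2 (hc'.toSchwartzMap hg')).2
  simpa using e1.symm.trans e2

open Classical in
/-- The Fourier transform of the function `u`, as a function determined up to null sets (and zero
if the Fourier transform of `u` is not given by a function). -/
def fourierFun (u : V → ℂ) : V → ℂ :=
  if h : ∃ v, IsFourierOf u v then h.choose else 0

/-- The function `|ξ|^{-a} [F u](ξ)`. The frequency `ξ` that is dual to the kernel `exp (-i x·ξ)`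
is `2π` times the frequency that is dual to Mathlib's kernel. -/
def rieszSymbol (a : ℝ) (u : V → ℂ) (ξ : V) : ℂ :=
  (((2 * Real.pi * ‖ξ‖) ^ (-a) : ℝ) : ℂ) * fourierFun u ξ

/-- The Riesz potential `I^a u = F⁻¹ (|ξ|^{-a} F u)`. -/
def rieszPotential (a : ℝ) (u : V → ℂ) : V → ℂ :=
  𝓕⁻ (rieszSymbol a u)

/-- The Riesz potential `I^a u` is well defined: the Fourier transform of `u` is a function, and
the integral of the inverse Fourier transform of `|ξ|^{-a} F u` converges absolutely. -/
def RieszDefined (a : ℝ) (u : V → ℂ) : Prop :=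
  (∃ v, IsFourierOf u v) ∧ Integrable (rieszSymbol a u) volume

end Riesz

/-! ### The filtered backprojection formula -/

/-- The dual Radon transform `[R^# g](x) = ∫_{S^{d-1}} g(ω, ω · x) dω`. -/
def dualRadon {d : ℕ} (g : S d → ℝ → ℂ) (x : E d) : ℂ :=
  ∫ ω : S d, g ω (inner ℝ (ω : E d) x) ∂((volume : Measure (E d)).toSphere)

/-- The filtered data `I^{α-d+1} g`, the Riesz potential being taken in the variable `p`. -/
def filtered {d : ℕ} (α : ℝ) (g : S d → ℝ → ℂ) (ω : S d) : ℝ → ℂ :=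
  rieszPotential (α - d + 1) (g ω)

/-- The filtered backprojection formula `R⁻¹ g = ½ (2π)^{1-d} I^{-α} R^# I^{α-d+1} g`. -/
def invRadon {d : ℕ} (α : ℝ) (g : S d → ℝ → ℂ) (x : E d) : ℂ :=
  (((1 / 2) * (2 * Real.pi) ^ (1 - (d : ℝ)) : ℝ) : ℂ) *
    rieszPotential (-α) (dualRadon (filtered α g)) x

/-- All the operations in the filtered backprojection formula are well defined for `g`. -/
def InvRadonDefined {d : ℕ} (α : ℝ) (g : S d → ℝ → ℂ) : Prop :=
  (∀ ω, RieszDefined (α - d + 1) (g ω)) ∧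
  (∀ x : E d, Integrable (fun ω : S d => filtered α g ω (inner ℝ (ω : E d) x))
    ((volume : Measure (E d)).toSphere)) ∧
  RieszDefined (-α) (dualRadon (filtered α g))

end

end VectorRadon

/-! Two facts carry the proof. (a) `invRadon_radon`: filtered backprojection inverts the Radon
transform of a scalar Schwartz function `f`. By the slice theorem `fourier_radon`, the filter in `p`
multiplies `f̂(σω)` by a multiple of `|σ|^(d-1-α)`. The factor `|σ|^(d-1)` is the Jacobian of polar
coordinates, so backprojection yields a multiple of `𝓕⁻(|ξ|^(-α) f̂)`, and `I^(-α)` removes the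
weight. The condition `α < d` makes both weights integrable at the origin. (b)
`hasDerivAt_transversal`: `∂_p D^⊥ G = R(div G)` for every Schwartz field `G`. In the basis `(ω,
ω_k)` the tangential derivatives integrate to zero over the hyperplane, and the normal one is `∂_p`.
Statement 1 is (b) for `F` followed by (a). For statement 2, apply (b) to `(ω_k · x) F`, whose
divergence is `(ω_k · x) Φ + ω_k · F`; this gives the tangential coefficients `R(ω_k · F)` of `𝔑F =
(R F_j)_j`. Statement 3 is (a) for each component. The frame is used for one `ω` at a time, so it
needs no regularity. -/

namespace VectorRadon

/-! ### Distributional Fourier transforms and Riesz potentials -/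

section FourierRiesz

variable {V : Type*} [NormedAddCommGroup V] [InnerProductSpace ℝ V] [FiniteDimensional ℝ V]
  [MeasurableSpace V] [BorelSpace V]

/-- Hölder's inequality against Schwartz functions; used for exponents `1` and `⊤`, the two sides of
the Fourier transform of an integrable function. -/
theorem isGivenBy_toTemperedDistribution {p : ENNReal} [hp : Fact (1 ≤ p)] {u : V → ℂ}
    (hu : MemLp u p) : IsGivenBy (Lp.toTemperedDistribution (hu.toLp u)) u := by
  refine ⟨hu.locallyIntegrable hp.out, fun ψ => ⟨?_, ?_⟩⟩
  · have := ENNReal.HolderConjugate.inv_one_sub_inv' hp.out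
    have hψ : MemLp ψ (1 - p⁻¹)⁻¹ volume := ψ.memLp _
    simpa only [mul_comm] using! hu.integrable_mul hψ
  · rw [Lp.toTemperedDistribution_apply]
    apply integral_congr_ae
    filter_upwards [hu.coeFn_toLp] with x hx
    rw [hx, smul_eq_mul]

theorem norm_fourier_le_integral_norm (u : V → ℂ) (ξ : V) : ‖𝓕 u ξ‖ ≤ ∫ x, ‖u x‖ :=
  VectorFourier.norm_fourierIntegral_le_integral_norm _ _ _ _ _

theorem continuous_fourier {u : V → ℂ} (hu : Integrable u) : Continuous (𝓕 u) :=
  VectorFourier.fourierIntegral_continuous Real.continuous_fourierChar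
    (L := innerₗ V) continuous_inner hu

theorem memLp_top_fourier {u : V → ℂ} (hu : Integrable u) : MemLp (𝓕 u) ⊤ :=
  memLp_top_of_bound (continuous_fourier hu).aestronglyMeasurable (∫ x, ‖u x‖)
    (ae_of_all _ (norm_fourier_le_integral_norm u))

theorem memLp_top_fourierInv {m : V → ℂ} (hm : Integrable m) : MemLp (𝓕⁻ m) ⊤ := by
  rw [Real.fourierInv_eq_fourier_comp_neg]
  exact memLp_top_fourier hm.comp_neg

theorem integral_fourier_mul_eq_of_integrable {u v : V → ℂ} (hu : Integrable u)
    (hv : Integrable v) : ∫ ξ, 𝓕 u ξ * v ξ = ∫ x, u x * 𝓕 v x := by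
  have := VectorFourier.integral_fourierIntegral_smul_eq_flip (L := innerₗ V)
    (μ := volume) (ν := volume) Real.continuous_fourierChar continuous_inner hu hv
  rw [flip_innerₗ] at this
  exact this

/-- The distributional Fourier transform of an integrable function is its Fourier integral. -/
theorem isFourierOf_fourier {u : V → ℂ} (hu : Integrable u) : IsFourierOf u (𝓕 u) := by
  have hu1 : MemLp u 1 := memLp_one_iff_integrable.2 hu
  have h1 := isGivenBy_toTemperedDistribution hu1
  have h2 := isGivenBy_toTemperedDistribution (memLp_top_fourier hu)
  refine ⟨_, h1, h2.1, fun ψ => ⟨(h2.2 ψ).1, ?_⟩⟩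
  rw [TemperedDistribution.fourier_apply, (h1.2 (𝓕 ψ)).2, SchwartzMap.fourier_coe]
  exact integral_fourier_mul_eq_of_integrable ψ.integrable hu

/-- An integrable function is the distributional Fourier transform of its inverse Fourier
integral. -/
theorem isFourierOf_fourierInv {m : V → ℂ} (hm : Integrable m) : IsFourierOf (𝓕⁻ m) m := by
  have hm1 : MemLp m 1 := memLp_one_iff_integrable.2 hm
  have h1 := isGivenBy_toTemperedDistribution (memLp_top_fourierInv hm)
  have h2 := isGivenBy_toTemperedDistribution hm1
  refine ⟨_, h1, h2.1, fun ψ => ⟨(h2.2 ψ).1, ?_⟩⟩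
  rw [TemperedDistribution.fourier_apply, (h1.2 (𝓕 ψ)).2, Real.fourierInv_eq_fourier_comp_neg]
  have := integral_fourier_mul_eq_of_integrable hm.comp_neg (𝓕 ψ).integrable
  simp_rw [mul_comm ((𝓕 ψ) _)]
  -- The reflection moves the double transform of `ψ` to `-x`, where it equals `ψ x`.
  rw [this, ← integral_neg_eq_self]
  refine integral_congr_ae (ae_of_all _ fun x => ?_)
  have : 𝓕 (⇑(𝓕 ψ : 𝓢(V, ℂ))) (-x) = ψ x := by
    rw [← Real.fourierInv_eq_fourier_neg, ← SchwartzMap.fourierInv_coe]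
    simp
  simp [this, mul_comm]

/-- `fourierFun` is an arbitrary choice; uniqueness up to null sets lets any known transform `v`
replace it. -/
theorem IsFourierOf.rieszSymbol_ae_eq {u v : V → ℂ} (h : IsFourierOf u v) (a : ℝ) :
    rieszSymbol a u =ᵐ[volume] fun ξ => (((2 * Real.pi * ‖ξ‖) ^ (-a) : ℝ) : ℂ) * v ξ := by
  have hex : ∃ v, IsFourierOf u v := ⟨v, h⟩
  have : fourierFun u =ᵐ[volume] v := by
    rw [fourierFun, dif_pos hex]
    exact hex.choose_spec.ae_eq h
  filter_upwards [this] with ξ hξ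
  rw [rieszSymbol, hξ]

theorem IsFourierOf.rieszDefined {u v : V → ℂ} (h : IsFourierOf u v) {a : ℝ}
    (hi : Integrable fun ξ => (((2 * Real.pi * ‖ξ‖) ^ (-a) : ℝ) : ℂ) * v ξ) : RieszDefined a u :=
  ⟨⟨v, h⟩, hi.congr (h.rieszSymbol_ae_eq a).symm⟩

theorem IsFourierOf.rieszPotential_eq {u v : V → ℂ} (h : IsFourierOf u v) (a : ℝ) :
    rieszPotential a u = 𝓕⁻ fun ξ => (((2 * Real.pi * ‖ξ‖) ^ (-a) : ℝ) : ℂ) * v ξ := by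
  ext x
  rw [rieszPotential, Real.fourierInv_eq_fourier_neg, Real.fourierInv_eq_fourier_neg,
    Real.fourier_congr_ae (h.rieszSymbol_ae_eq a)]

/-- A homogeneous weight of degree `s > -dim V` times a Schwartz function is integrable. -/
theorem integrable_rpow_norm_mul_schwartz [Nontrivial V] {s : ℝ}
    (hs : -(Module.finrank ℝ V : ℝ) < s) (f : 𝓢(V, ℂ)) :
    Integrable fun ξ => (((2 * Real.pi * ‖ξ‖) ^ s : ℝ) : ℂ) * f ξ := by
  have hmeas : AEStronglyMeasurable (fun ξ : V => ‖ξ‖ ^ s * ‖f ξ‖) :=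
    ((measurable_norm.pow_const s).mul f.continuous.norm.measurable).aestronglyMeasurable
  have key : Integrable fun ξ : V => ‖ξ‖ ^ s * ‖f ξ‖ := by
    have hunion : (Set.univ : Set V) = ball 0 1 ∪ (ball 0 1)ᶜ := by simp
    rw [← integrableOn_univ, hunion]
    refine IntegrableOn.union ?_ ?_
    · obtain ⟨C, hC⟩ := f.decay 0 0
      have hb : IntegrableOn (fun ξ : V => ‖ξ‖ ^ s) (ball 0 1) := by
        rw [integrableOn_fun_norm_addHaar volume (f := fun r => r ^ s)]
        have hpos : (1 : ℝ) ≤ Module.finrank ℝ V := by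
          exact_mod_cast Module.finrank_pos (R := ℝ) (M := V)
        have h1 : IntegrableOn (fun r : ℝ => r ^ ((Module.finrank ℝ V : ℝ) - 1 + s))
            (Set.Ioo 0 1) :=
          (intervalIntegral.integrableOn_Ioo_rpow_iff zero_lt_one).2 (by linarith)
        refine h1.congr_fun (fun r hr => ?_) measurableSet_Ioo
        simp only [smul_eq_mul]
        rw [Real.rpow_add hr.1, ← Real.rpow_natCast,
          Nat.cast_sub Module.finrank_pos, Nat.cast_one]
      refine (hb.mul_const C).mono' hmeas.restrict (ae_of_all _ fun ξ => ?_)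
      have := hC.2 ξ
      simp only [pow_zero, norm_iteratedFDeriv_zero, one_mul] at this
      rw [Real.norm_of_nonneg (by positivity)]
      gcongr
    -- Outside the unit ball `‖ξ‖ ^ s ≤ ‖ξ‖ ^ ⌈s⌉₊`, also for negative `s`, where `⌈s⌉₊ = 0`.
    · refine (f.integrable_pow_mul volume ⌈s⌉₊).integrableOn.mono' hmeas.restrict ?_
      filter_upwards [ae_restrict_mem measurableSet_ball.compl] with ξ hξ
      have h1 : 1 ≤ ‖ξ‖ := by simpa using hξ
      rw [Real.norm_of_nonneg (by positivity), ← Real.rpow_natCast]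
      gcongr
      exact Nat.le_ceil s
  refine (key.const_mul ((2 * Real.pi) ^ s)).mono ?_ (ae_of_all _ fun ξ => ?_)
  · exact (((measurable_const.mul measurable_norm).pow_const s).complex_ofReal.mul
      f.continuous.measurable).aestronglyMeasurable
  · rw [norm_mul, Complex.norm_real, Real.mul_rpow (by positivity) (norm_nonneg _)]
    simp only [norm_mul, norm_norm]
    rw [mul_assoc]

end FourierRiesz

/-! ### Polar coordinates over rays and over lines -/

section Polar

variable {V : Type*} [NormedAddCommGroup V] [NormedSpace ℝ V] [FiniteDimensional ℝ V]
  [Nontrivial V] [MeasurableSpace V] [BorelSpace V] {μ : Measure V} [μ.IsAddHaarMeasure]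

theorem integral_volumeIoiPow (n : ℕ) (g : ℝ → ℂ) :
    ∫ r : Set.Ioi (0 : ℝ), g r ∂(Measure.volumeIoiPow n) = ∫ r in Set.Ioi (0 : ℝ), r ^ n • g r := by
  simp only [Measure.volumeIoiPow, ENNReal.ofReal]
  rw [integral_withDensity_eq_integral_smul,
    integral_subtype_comap measurableSet_Ioi fun a ↦ Real.toNNReal (a ^ n) • g a,
    setIntegral_congr_fun measurableSet_Ioi fun x hx ↦ ?_]
  · rw [NNReal.smul_def, Real.coe_toNNReal _ (pow_nonneg (le_of_lt hx) _)]
  · exact (measurable_subtype_coe.pow_const _).real_toNNReal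

/-- Integration in polar coordinates. -/
theorem integral_polar {K : V → ℂ} (hK : Integrable K μ) :
    Integrable (fun ω : sphere (0 : V) 1 =>
      ∫ r in Set.Ioi (0 : ℝ), r ^ (Module.finrank ℝ V - 1) • K (r • (ω : V))) μ.toSphere ∧
    ∫ ω : sphere (0 : V) 1,
      (∫ r in Set.Ioi (0 : ℝ), r ^ (Module.finrank ℝ V - 1) • K (r • (ω : V))) ∂μ.toSphere =
      ∫ x, K x ∂μ := by
  have hmp := μ.measurePreserving_homeomorphUnitSphereProd
  have hemb := (homeomorphUnitSphereProd V).measurableEmbedding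
  set G : sphere (0 : V) 1 × Set.Ioi (0 : ℝ) → ℂ := fun z => K ((z.2 : ℝ) • (z.1 : V)) with hG
  have hcomp : G ∘ homeomorphUnitSphereProd V = fun x : ({0}ᶜ : Set V) => K (x : V) := by
    ext x
    have := congrArg Subtype.val ((homeomorphUnitSphereProd V).symm_apply_apply x)
    simp only [homeomorphUnitSphereProd_symm_apply_coe] at this
    simp only [hG, Function.comp_apply, this]
  have hGi : Integrable G (μ.toSphere.prod (Measure.volumeIoiPow (Module.finrank ℝ V - 1))) := by
    rw [← hmp.integrable_comp_emb hemb, hcomp]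
    have := hK.integrableOn (s := {(0 : V)}ᶜ)
    rwa [integrableOn_iff_comap_subtypeVal (measurableSet_singleton _).compl] at this
  have hGe : ∫ z, G z ∂(μ.toSphere.prod (Measure.volumeIoiPow (Module.finrank ℝ V - 1))) =
      ∫ x, K x ∂μ := by
    rw [← hmp.integral_comp hemb]
    have h := integral_subtype_comap (μ := μ) (measurableSet_singleton (0 : V)).compl K
    rw [restrict_compl_singleton] at h
    rw [← h]
    exact integral_congr_ae (ae_of_all _ fun x => congrFun hcomp x)
  have hin : ∀ ω : sphere (0 : V) 1,
      ∫ r, G (ω, r) ∂(Measure.volumeIoiPow (Module.finrank ℝ V - 1)) =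
      ∫ r in Set.Ioi (0 : ℝ), r ^ (Module.finrank ℝ V - 1) • K (r • (ω : V)) :=
    fun ω => integral_volumeIoiPow _ fun r => K (r • (ω : V))
  simp_rw [← hin]
  exact ⟨hGi.integral_prod_left, by rw [← hGe, integral_prod _ hGi]⟩

/-- Integration in polar coordinates over full lines through the origin, which cover the space
twice. -/
theorem integral_polar_line {K : V → ℂ} (hK : Integrable K μ)
    (hline : ∀ ω : sphere (0 : V) 1, Integrable fun σ : ℝ =>
      |σ| ^ (Module.finrank ℝ V - 1) • K (σ • (ω : V))) :
    Integrable (fun ω : sphere (0 : V) 1 =>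
      ∫ σ : ℝ, |σ| ^ (Module.finrank ℝ V - 1) • K (σ • (ω : V))) μ.toSphere ∧
    ∫ ω : sphere (0 : V) 1,
      (∫ σ : ℝ, |σ| ^ (Module.finrank ℝ V - 1) • K (σ • (ω : V))) ∂μ.toSphere =
      2 * ∫ x, K x ∂μ := by
  have hneg := integral_polar hK.comp_neg
  have hpos := integral_polar hK
  have hsplit : ∀ ω : sphere (0 : V) 1,
      (∫ σ : ℝ, |σ| ^ (Module.finrank ℝ V - 1) • K (σ • (ω : V))) =
      (∫ r in Set.Ioi (0 : ℝ), r ^ (Module.finrank ℝ V - 1) • K (-(r • (ω : V)))) +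
      ∫ r in Set.Ioi (0 : ℝ), r ^ (Module.finrank ℝ V - 1) • K (r • (ω : V)) := by
    intro ω
    -- Integrability of `K` alone would give integrability only on almost every line, hence the
    -- hypothesis `hline`.
    have h := integral_add_compl (measurableSet_Iic (a := (0 : ℝ))) (hline ω)
    rw [Set.compl_Iic] at h
    rw [← h]
    congr 1
    · have := integral_comp_neg_Ioi (0 : ℝ)
        (fun σ : ℝ => |σ| ^ (Module.finrank ℝ V - 1) • K (σ • (ω : V)))
      rw [neg_zero] at this
      rw [← this]
      refine setIntegral_congr_fun measurableSet_Ioi fun r hr => ?_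
      simp only [abs_neg, abs_of_pos (Set.mem_Ioi.1 hr), neg_smul]
    · refine setIntegral_congr_fun measurableSet_Ioi fun r hr => ?_
      simp only [abs_of_pos (Set.mem_Ioi.1 hr)]
  simp_rw [hsplit]
  refine ⟨hneg.1.add hpos.1, ?_⟩
  rw [integral_add hneg.1 hpos.1, hneg.2, hpos.2, integral_neg_eq_self, two_mul]

end Polar

/-! ### Radon transforms of Schwartz functions and the slice theorem -/

section Slices

open scoped LineDeriv

variable {d : ℕ}

/-- The linear hyperplane `ω^⊥`. -/
noncomputable abbrev Hyper (ω : S d) : Submodule ℝ (E d) := (Submodule.span ℝ {(ω : E d)})ᗮ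

@[simp]
theorem norm_sphere_coe (ω : S d) : ‖(ω : E d)‖ = 1 := by simp

theorem inner_hyper (ω : S d) (y : Hyper ω) : inner ℝ (ω : E d) (y : E d) = 0 :=
  Submodule.mem_orthogonal_singleton_iff_inner_right.1 y.2

/-- Pythagoras. The bound does not involve `p`, so decay in `y` is uniform over parallel
hyperplanes. -/
theorem norm_le_norm_slice (ω : S d) (p : ℝ) (y : Hyper ω) :
    ‖y‖ ≤ ‖p • (ω : E d) + (y : E d)‖ := by
  have h := norm_add_sq_eq_norm_sq_add_norm_sq_real
    (x := p • (ω : E d)) (y := (y : E d)) (by rw [inner_smul_left, inner_hyper, mul_zero])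
  change ‖(y : E d)‖ ≤ _
  nlinarith [norm_nonneg (p • (ω : E d) + (y : E d)), norm_nonneg (p • (ω : E d)),
    norm_nonneg (y : E d)]

theorem hasTemperateGrowth_slice (ω : S d) (p : ℝ) :
    (fun y : Hyper ω => p • (ω : E d) + (y : E d)).HasTemperateGrowth :=
  (Function.HasTemperateGrowth.const _).add (Hyper ω).subtypeL.hasTemperateGrowth

theorem antilipschitz_slice (ω : S d) (p : ℝ) :
    AntilipschitzWith 1 (fun y : Hyper ω => p • (ω : E d) + (y : E d)) :=
  AntilipschitzWith.of_le_mul_dist fun x y => by simp [Subtype.dist_eq]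

/-- The restriction of a Schwartz function to the hyperplane `Π(ω, p)`. -/
noncomputable def slice {F : Type*} [NormedAddCommGroup F] [NormedSpace ℝ F]
    (f : 𝓢(E d, F)) (ω : S d) (p : ℝ) : 𝓢(Hyper ω, F) :=
  SchwartzMap.compCLMOfAntilipschitz ℝ (hasTemperateGrowth_slice ω p) (antilipschitz_slice ω p) f

theorem radonIntegrable_schwartz (f : 𝓢(E d, ℝ)) (ω : S d) (p : ℝ) : RadonIntegrable f ω p :=
  (slice f ω p).integrable

/-- A Schwartz function is bounded by an integrable function, uniformly over parallel
hyperplanes. -/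
theorem exists_integrable_bound (f : 𝓢(E d, ℝ)) (ω : S d) :
    ∃ B : Hyper ω → ℝ, Integrable B ∧ 
      ∀ (p : ℝ) (y : Hyper ω), ‖f (p • (ω : E d) + (y : E d))‖ ≤ B y := by
  -- One more than the dimension of the hyperplane makes `(1 + ‖y‖) ^ (-k)` integrable.
  set k := Module.finrank ℝ (Hyper ω) + 1 with hk
  set C := 2 ^ k * ((Finset.Iic (k, 0)).sup fun m => SchwartzMap.seminorm ℝ m.1 m.2) f
  refine ⟨fun y => C * (1 + ‖y‖) ^ (-(k : ℝ)), ?_, fun p y => ?_⟩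
  · exact (integrable_one_add_norm (by rw [hk]; push_cast; linarith)).const_mul C
  · have h := SchwartzMap.one_add_le_sup_seminorm_apply (𝕜 := ℝ) (m := (k, 0)) le_rfl le_rfl f
      (p • (ω : E d) + (y : E d))
    rw [norm_iteratedFDeriv_zero] at h
    beta_reduce
    rw [Real.rpow_neg (by positivity), Real.rpow_natCast, ← div_eq_mul_inv,
      le_div_iff₀ (by positivity), mul_comm]
    refine le_trans ?_ h
    gcongr
    exact norm_le_norm_slice ω p y

/-- Changing `p` moves the hyperplane along `ω`; the uniform bound on `∂_ω f` justifies
differentiation under the integral. -/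
theorem hasDerivAt_radon (f : 𝓢(E d, ℝ)) (ω : S d) (p : ℝ) :
    HasDerivAt (radon f ω) (radon (∂_{(ω : E d)} f : 𝓢(E d, ℝ)) ω p) p := by
  obtain ⟨B, hB, hfB⟩ := exists_integrable_bound (∂_{(ω : E d)} f) ω
  refine (hasDerivAt_integral_of_dominated_loc_of_deriv_le (s := Set.univ) (bound := B)
    Filter.univ_mem
    (Filter.Eventually.of_forall fun q => (slice f ω q).continuous.aestronglyMeasurable)
    (slice f ω p).integrable
    (F' := fun q y => (∂_{(ω : E d)} f) (q • (ω : E d) + (y : E d)))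
    (slice (∂_{(ω : E d)} f) ω p).continuous.aestronglyMeasurable
    (ae_of_all _ fun y q _ => hfB q y) hB (ae_of_all _ fun y q _ => ?_)).2
  rw [SchwartzMap.lineDerivOp_apply_eq_fderiv]
  have h2 : HasDerivAt (fun q : ℝ => q • (ω : E d) + (y : E d)) (ω : E d) q := by
    simpa using ((hasDerivAt_id q).smul_const (ω : E d)).add_const (y : E d)
  exact (f.hasFDerivAt _).comp_hasDerivAt q h2

theorem radon_lineDeriv_eq_zero (f : 𝓢(E d, ℝ)) (ω : S d) (p : ℝ) {v : E d}
    (hv : inner ℝ (ω : E d) v = 0) : radon (∂_{v} f : 𝓢(E d, ℝ)) ω p = 0 := by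
  set w : Hyper ω := ⟨v, Submodule.mem_orthogonal_singleton_iff_inner_right.2 hv⟩
  have hd : ∀ y, fderiv ℝ (slice f ω p) y w = (∂_{v} f) (p • (ω : E d) + (y : E d)) := by
    intro y
    rw [SchwartzMap.lineDerivOp_apply_eq_fderiv]
    have h2 : HasFDerivAt (fun y : Hyper ω => p • (ω : E d) + (y : E d)) (Hyper ω).subtypeL y :=
      (Hyper ω).subtypeL.hasFDerivAt.const_add _
    have h3 := (f.hasFDerivAt (p • (ω : E d) + (y : E d))).comp y h2
    have h4 : fderiv ℝ (slice f ω p) y = _ := h3.fderiv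
    rw [h4]
    rfl
  have hi : Integrable fun y => fderiv ℝ (slice f ω p) y w := by
    simp_rw [hd]
    exact radonIntegrable_schwartz (∂_{v} f) ω p
  -- Since `v` is tangent to the hyperplane, integration by parts against the constant `1` leaves
  -- nothing.
  have h := integral_mul_fderiv_eq_neg_fderiv_mul_of_integrable (μ := volume)
    (f := fun _ : Hyper ω => (1 : ℝ)) (g := slice f ω p) (v := w) (by simp)
    (by simpa using hi) (by simpa using (slice f ω p).integrable)
    (fun _ _ => by fun_prop) (fun _ _ => (slice f ω p).differentiableAt)
  simp only [one_mul, hd, fderiv_fun_const, Pi.zero_apply, zero_apply, zero_mul,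
    integral_zero, neg_zero] at h
  exact h

/-- The isometry `(p, y) ↦ p ω + y` preserves volume. -/
theorem measurePreserving_slices (ω : S d) :
    MeasurePreserving (fun z : ℝ × Hyper ω => z.1 • (ω : E d) + (z.2 : E d)) := by
  set e := LinearIsometryEquiv.toSpanUnitSingleton (𝕜 := ℝ) (ω : E d) (norm_sphere_coe ω)
  have h1 : MeasurePreserving (Prod.map e (id : Hyper ω → Hyper ω))
      (volume.prod volume) (volume.prod volume) :=
    e.measurePreserving.prod (MeasurePreserving.id volume)
  have h2 := WithLp.volume_preserving_toLp (U := Submodule.span ℝ {(ω : E d)}) (V := Hyper ω)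
  have h3 := (Submodule.span ℝ {(ω : E d)}).orthogonalDecomposition.symm.measurePreserving
  have h := (h3.comp h2).comp h1
  convert! h using 2 with z

theorem measurableEmbedding_slices (ω : S d) :
    MeasurableEmbedding (fun z : ℝ × Hyper ω => z.1 • (ω : E d) + (z.2 : E d)) := by
  refine Continuous.measurableEmbedding (by fun_prop) fun z w h => ?_
  have h1 : z.1 = w.1 := by
    have := congrArg (inner ℝ (ω : E d)) h
    simpa [inner_add_right, inner_smul_right, inner_hyper] using this
  refine Prod.ext h1 (Subtype.ext ?_)
  simpa [h1] using h

theorem integrable_radon (f : 𝓢(E d, ℝ)) (ω : S d) : Integrable (radon f ω) := by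
  have h := ((measurePreserving_slices ω).integrable_comp_emb
    (measurableEmbedding_slices ω)).2 (f.integrable (μ := volume))
  exact Integrable.integral_prod_left h

/-- The Fourier slice theorem. -/
theorem fourier_radon (f : 𝓢(E d, ℝ)) (ω : S d) (σ : ℝ) :
    𝓕 (fun p => (radon f ω p : ℂ)) σ = 𝓕 (fun x => (f x : ℂ)) (σ • (ω : E d)) := by
  have hfc : Integrable (fun x => (f x : ℂ)) := (f.integrable (μ := volume)).ofReal
  have hK := (Real.fourierIntegral_convergent_iff (σ • (ω : E d))).2 hfc
  have h := ((measurePreserving_slices ω).integrable_comp_emb (measurableEmbedding_slices ω)).2 hK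
  rw [Real.fourier_eq, Real.fourier_eq,
    ← (measurePreserving_slices ω).integral_comp (measurableEmbedding_slices ω)]
  rw [Measure.volume_eq_prod] at h ⊢
  erw [integral_prod _ h]
  congr 1
  ext p
  -- On the slice at height `p` the phase `x · σω` is the constant `pσ`.
  rw [radon, ← integral_complex_ofReal, Circle.smul_def, smul_eq_mul, ← integral_const_mul]
  congr 1
  ext y
  rw [Function.comp_apply, Circle.smul_def, smul_eq_mul]
  congr 4
  simp [inner_add_left, inner_smul_left, inner_smul_right, inner_hyper,
    real_inner_comm (ω : E d) (y : E d)]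

end Slices

/-! ### Inversion by filtered backprojection -/

section Inversion

variable {d : ℕ}

/-- The Fourier transform of a real Schwartz function, as a complex Schwartz function. -/
noncomputable def fourierComplex (f : 𝓢(E d, ℝ)) : 𝓢(E d, ℂ) :=
  𝓕 (SchwartzMap.postcompCLM Complex.ofRealCLM f : 𝓢(E d, ℂ))

theorem fourierComplex_apply (f : 𝓢(E d, ℝ)) (ξ : E d) :
    fourierComplex f ξ = 𝓕 (fun x => (f x : ℂ)) ξ := rfl

theorem fourierInv_fourierComplex (f : 𝓢(E d, ℝ)) (x : E d) :
    𝓕⁻ (fourierComplex f : E d → ℂ) x = f x := by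
  rw [← SchwartzMap.fourierInv_coe, fourierComplex]
  simp

/-- The restriction of a Schwartz function to the line through the origin in direction `ω`. -/
noncomputable def lineRestrict (f : 𝓢(E d, ℂ)) (ω : S d) : 𝓢(ℝ, ℂ) :=
  SchwartzMap.compCLMOfAntilipschitz ℝ (g := fun σ : ℝ => σ • (ω : E d)) (K := 1)
    ((ContinuousLinearMap.id ℝ ℝ).smulRight (ω : E d)).hasTemperateGrowth
    (AntilipschitzWith.of_le_mul_dist fun x y => by
      simp [dist_eq_norm, ← sub_smul, norm_smul]) f

theorem lineRestrict_apply (f : 𝓢(E d, ℂ)) (ω : S d) (σ : ℝ) :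
    lineRestrict f ω σ = f (σ • (ω : E d)) := rfl

theorem isFourierOf_radon (f : 𝓢(E d, ℝ)) (ω : S d) :
    IsFourierOf (fun p => (radon f ω p : ℂ)) (lineRestrict (fourierComplex f) ω) := by
  have h := isFourierOf_fourier ((integrable_radon f ω).ofReal (𝕜 := ℂ))
  have he : 𝓕 (fun p => (radon f ω p : ℂ)) = lineRestrict (fourierComplex f) ω := by
    ext σ
    rw [fourier_radon, lineRestrict_apply, fourierComplex_apply]
  exact he ▸ h

/-- The function `|ξ|^{-α} f̂(ξ)`. -/
noncomputable def weightedFourier (α : ℝ) (f : 𝓢(E d, ℝ)) (ξ : E d) : ℂ :=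
  (((2 * Real.pi * ‖ξ‖) ^ (-α) : ℝ) : ℂ) * fourierComplex f ξ

theorem nontrivial_of_pos (hd : 0 < d) : Nontrivial (E d) :=
  Module.nontrivial_of_finrank_pos (R := ℝ) (by simpa using hd)

theorem integrable_weightedFourier (hd : 0 < d) {α : ℝ} (hα : α < d) (f : 𝓢(E d, ℝ)) :
    Integrable (weightedFourier α f) := by
  have := nontrivial_of_pos hd
  exact integrable_rpow_norm_mul_schwartz (by simpa using hα) _

/-- The exponent is `d - 1 - α`, and integrability at the origin of `ℝ` asks that it exceed `-1`:
again `α < d`. -/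
theorem integrable_rieszSymbol_radon {α : ℝ} (hα : α < d) (f : 𝓢(E d, ℝ)) (ω : S d) :
    Integrable fun σ : ℝ => (((2 * Real.pi * ‖σ‖) ^ (-(α - d + 1)) : ℝ) : ℂ) *
      lineRestrict (fourierComplex f) ω σ :=
  integrable_rpow_norm_mul_schwartz (by simp; linarith) _

/-- The filter exponent `d - 1 - α` splits into the polar Jacobian and the weight of
`weightedFourier`. At `σ = 0` the convention `0 ^ 0 = 1` can break the identity. -/
theorem filtered_radon_integrand (hd : 0 < d) (α : ℝ) (f : 𝓢(E d, ℝ)) (ω : S d) (x : E d) {σ : ℝ}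
    (hσ : σ ≠ 0) :
    Real.fourierChar (inner ℝ σ (inner ℝ (ω : E d) x)) •
      ((((2 * Real.pi * ‖σ‖) ^ (-(α - d + 1)) : ℝ) : ℂ) * lineRestrict (fourierComplex f) ω σ) =
    (((2 * Real.pi) ^ (d - 1) : ℝ) : ℂ) * (|σ| ^ (d - 1) •
      (Real.fourierChar (inner ℝ (σ • (ω : E d)) x) • weightedFourier α f (σ • (ω : E d)))) := by
  have h1 : (2 * Real.pi * |σ|) ^ (-(α - d + 1)) =
      (2 * Real.pi) ^ (d - 1) * |σ| ^ (d - 1) * (2 * Real.pi * |σ|) ^ (-α) := by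
    have hpos : 0 < 2 * Real.pi * |σ| := by positivity
    rw [← mul_pow, ← Real.rpow_natCast, ← Real.rpow_add hpos, Nat.cast_sub hd]
    congr 1
    push_cast
    ring
  have h2 : inner ℝ σ (inner ℝ (ω : E d) x : ℝ) = σ * inner ℝ (ω : E d) x := by simp [mul_comm]
  rw [weightedFourier, norm_smul, norm_sphere_coe, mul_one, Real.norm_eq_abs, h1,
    lineRestrict_apply, inner_smul_left, h2]
  simp only [Circle.smul_def, smul_eq_mul, Complex.real_smul, Complex.ofReal_mul]
  simp only [conj_trivial]
  ring

theorem filtered_radon (hd : 0 < d) (α : ℝ) (f : 𝓢(E d, ℝ)) (ω : S d) (x : E d) :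
    filtered α (fun (ω : S d) p => (radon f ω p : ℂ)) ω (inner ℝ (ω : E d) x) =
      (((2 * Real.pi) ^ (d - 1) : ℝ) : ℂ) * ∫ σ : ℝ, |σ| ^ (d - 1) •
        (Real.fourierChar (inner ℝ (σ • (ω : E d)) x) • weightedFourier α f (σ • (ω : E d))) := by
  rw [filtered, (isFourierOf_radon f ω).rieszPotential_eq, Real.fourierInv_eq,
    ← integral_const_mul]
  refine integral_congr_ae ?_
  filter_upwards [Measure.ae_ne volume (0 : ℝ)] with σ hσ
  exact filtered_radon_integrand hd α f ω x hσ

theorem dualRadon_filtered_radon (hd : 0 < d) {α : ℝ} (hα : α < d) (f : 𝓢(E d, ℝ)) (x : E d) :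
    Integrable (fun ω : S d =>
      filtered α (fun (ω : S d) p => (radon f ω p : ℂ)) ω (inner ℝ (ω : E d) x))
      ((volume : Measure (E d)).toSphere) ∧
    dualRadon (filtered α (fun (ω : S d) p => (radon f ω p : ℂ))) x =
      ((2 * (2 * Real.pi) ^ (d - 1) : ℝ) : ℂ) * 𝓕⁻ (weightedFourier α f) x := by
  have := nontrivial_of_pos hd
  have hc : (((2 * Real.pi) ^ (d - 1) : ℝ) : ℂ) ≠ 0 := by
    exact_mod_cast (by positivity : (2 * Real.pi) ^ (d - 1) ≠ 0)
  have hm := integrable_weightedFourier hd hα f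
  have hK : Integrable fun ξ : E d => Real.fourierChar (inner ℝ ξ x) • weightedFourier α f ξ := by
    simpa using (Real.fourierIntegral_convergent_iff (-x)).2 hm
  have hline : ∀ ω : S d, Integrable fun σ : ℝ => |σ| ^ (Module.finrank ℝ (E d) - 1) •
      (Real.fourierChar (inner ℝ (σ • (ω : E d)) x) • weightedFourier α f (σ • (ω : E d))) := by
    intro ω
    have h1 := (Real.fourierIntegral_convergent_iff (-(inner ℝ (ω : E d) x : ℝ))).2
      (integrable_rieszSymbol_radon hα f ω)
    refine (h1.const_mul (((2 * Real.pi) ^ (d - 1) : ℝ) : ℂ)⁻¹).congr ?_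
    filter_upwards [Measure.ae_ne volume (0 : ℝ)] with σ hσ
    rw [inner_neg_right, neg_neg, filtered_radon_integrand hd α f ω x hσ, inv_mul_cancel_left₀ hc,
      finrank_euclideanSpace_fin]
  -- Here the factor `2` enters: each line is counted for `ω` and for `-ω`.
  obtain ⟨hi, he⟩ := integral_polar_line hK hline
  rw [finrank_euclideanSpace_fin] at hi he
  refine ⟨?_, ?_⟩
  · simp_rw [filtered_radon hd]
    exact hi.const_mul _
  · simp_rw [dualRadon, filtered_radon hd]
    rw [integral_const_mul, he, Real.fourierInv_eq]
    push_cast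
    ring

/-- The filtered backprojection formula inverts the Radon transform of Schwartz functions. -/
theorem invRadon_radon (hd : 0 < d) {α : ℝ} (hα : α < d) (f : 𝓢(E d, ℝ)) :
    InvRadonDefined α (fun (ω : S d) p => (radon f ω p : ℂ)) ∧
    ∀ x, (f x : ℂ) = invRadon α (fun (ω : S d) p => (radon f ω p : ℂ)) x := by
  have := nontrivial_of_pos hd
  set c : ℂ := ((2 * (2 * Real.pi) ^ (d - 1) : ℝ) : ℂ) with hc
  have hdual : dualRadon (filtered α (fun (ω : S d) p => (radon f ω p : ℂ))) =
      𝓕⁻ (fun ξ => c * weightedFourier α f ξ) := by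
    ext x
    rw [(dualRadon_filtered_radon hd hα f x).2, ← hc, Real.fourierInv_eq, Real.fourierInv_eq,
      ← integral_const_mul]
    simp_rw [Circle.smul_def, smul_eq_mul, mul_left_comm c]
  -- Integrability of the backprojected data is not needed: its transform is known because it is the
  -- inverse transform of an integrable function.
  have hF : IsFourierOf (dualRadon (filtered α (fun (ω : S d) p => (radon f ω p : ℂ))))
      (fun ξ => c * weightedFourier α f ξ) :=
    hdual ▸ isFourierOf_fourierInv ((integrable_weightedFourier hd hα f).const_mul c)
  have hsymb : (fun ξ : E d => (((2 * Real.pi * ‖ξ‖) ^ (-(-α)) : ℝ) : ℂ) *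
      (c * weightedFourier α f ξ)) =ᵐ[volume] fun ξ => c * fourierComplex f ξ := by
    filter_upwards [Measure.ae_ne volume (0 : E d)] with ξ hξ
    have hpos : 0 < 2 * Real.pi * ‖ξ‖ := by positivity
    have h1 : (((2 * Real.pi * ‖ξ‖) ^ (-(-α)) : ℝ) : ℂ) *
        (((2 * Real.pi * ‖ξ‖) ^ (-α) : ℝ) : ℂ) = 1 := by
      rw [← Complex.ofReal_mul, ← Real.rpow_add hpos, neg_add_cancel, Real.rpow_zero,
        Complex.ofReal_one]
    rw [weightedFourier]
    linear_combination (c * fourierComplex f ξ) * h1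
  refine ⟨⟨fun ω => (isFourierOf_radon f ω).rieszDefined (integrable_rieszSymbol_radon hα f ω),
    fun x => (dualRadon_filtered_radon hd hα f x).1,
    hF.rieszDefined (((fourierComplex f).integrable.const_mul c).congr hsymb.symm)⟩, fun x => ?_⟩
  rw [invRadon, hF.rieszPotential_eq, Real.fourierInv_eq_fourier_neg,
    Real.fourier_congr_ae hsymb, ← Real.fourierInv_eq_fourier_neg]
  have h2 : 𝓕⁻ (fun ξ => c * fourierComplex f ξ) x = c * f x := by
    rw [← fourierInv_fourierComplex, Real.fourierInv_eq, Real.fourierInv_eq, ← integral_const_mul]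
    simp_rw [Circle.smul_def, smul_eq_mul, mul_left_comm c]
  -- The normalisation `½ (2π)^(1-d)` exactly cancels the double covering and the `2π` in the
  -- frequency variable.
  have h3 : ((((1 / 2) * (2 * Real.pi) ^ (1 - (d : ℝ)) : ℝ) : ℂ)) * c = 1 := by
    rw [hc, ← Complex.ofReal_mul, ← Complex.ofReal_one]
    congr 1
    have : (2 * Real.pi) ^ (1 - (d : ℝ)) * (2 * Real.pi) ^ (d - 1) = 1 := by
      rw [← Real.rpow_natCast, ← Real.rpow_add (by positivity), Nat.cast_sub hd]
      simp
    linear_combination this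
  rw [h2, ← mul_assoc, h3, one_mul]

end Inversion

/-! ### Divergence and the transversal transforms -/

section VectorFields

open scoped LineDeriv

variable {d : ℕ}

/-- The component `x ↦ v · F(x)` of a Schwartz vector field. -/
noncomputable def component (v : E d) (F : 𝓢(E d, E d)) : 𝓢(E d, ℝ) :=
  SchwartzMap.postcompCLM (innerSL ℝ v) F

@[simp]
theorem component_apply (v : E d) (F : 𝓢(E d, E d)) (x : E d) :
    component v F x = inner ℝ v (F x) := rfl

theorem lineDeriv_component (v w : E d) (F : 𝓢(E d, E d)) (x : E d) :
    (∂_{w} (component v F) : 𝓢(E d, ℝ)) x = inner ℝ v (fderiv ℝ F x w) := by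
  rw [SchwartzMap.lineDerivOp_apply_eq_fderiv]
  have h : HasFDerivAt (component v F) ((innerSL ℝ v).comp (fderiv ℝ F x)) x :=
    (innerSL ℝ v).hasFDerivAt.comp x (F.hasFDerivAt x)
  rw [h.fderiv]
  rfl

/-- The divergence of a Schwartz vector field, as a Schwartz function. -/
noncomputable def divergenceSchwartz (F : 𝓢(E d, E d)) : 𝓢(E d, ℝ) :=
  ∑ j, ∂_{EuclideanSpace.single j (1 : ℝ)} (component (EuclideanSpace.single j 1) F)

theorem coe_divergenceSchwartz (F : 𝓢(E d, E d)) : ⇑(divergenceSchwartz F) = divergence F := by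
  ext x
  rw [divergenceSchwartz, sum_apply, divergence]
  refine Finset.sum_congr rfl fun j _ => ?_
  rw [lineDeriv_component]
  simp [EuclideanSpace.inner_single_left]

/-- The divergence in an arbitrary orthonormal basis. -/
theorem divergence_eq_sum {ι : Type*} [Fintype ι] (e : OrthonormalBasis ι ℝ (E d))
    (F : E d → E d) (x : E d) :
    divergence F x = ∑ i, inner ℝ (e i) (fderiv ℝ F x (e i)) := by
  -- The divergence is the trace of the derivative, hence independent of the orthonormal basis.
  have h1 := LinearMap.trace_eq_sum_inner (fderiv ℝ F x : E d →ₗ[ℝ] E d) e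
  have h2 := LinearMap.trace_eq_sum_inner (fderiv ℝ F x : E d →ₗ[ℝ] E d)
    (EuclideanSpace.basisFun (Fin d) ℝ)
  rw [h1] at h2
  simp only [ContinuousLinearMap.coe_coe] at h2
  rw [h2, divergence]
  simp [EuclideanSpace.inner_single_left]

/-- The orthonormal basis `(ω, ω₁, …, ω_{d-1})`. -/
theorem exists_orthonormalBasis (hd : 0 < d) (ω : S d) {w : Fin (d - 1) → E d}
    (hw : Orthonormal ℝ w) (hωw : ∀ k, inner ℝ (ω : E d) (w k) = 0) :
    ∃ e : OrthonormalBasis (Option (Fin (d - 1))) ℝ (E d),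
      e none = ω ∧ ∀ k, e (some k) = w k := by
  set v : Option (Fin (d - 1)) → E d := fun o => o.elim (ω : E d) w with hv
  have hon : Orthonormal ℝ v := by
    refine ⟨fun i => ?_, fun i j hij => ?_⟩
    · cases i
      · exact norm_sphere_coe ω
      · exact hw.1 _
    · cases i <;> cases j
      · exact absurd rfl hij
      · exact hωw _
      · exact (real_inner_comm _ _).trans (hωw _)
      · exact hw.2 fun h => hij (congrArg some h)
  -- The index `none` stands for `ω`; the count `(d - 1) + 1 = d` needs `0 < d`.
  have hcard : Fintype.card (Option (Fin (d - 1))) = Module.finrank ℝ (E d) := by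
    simp only [Fintype.card_option, Fintype.card_fin, finrank_euclideanSpace_fin]
    omega
  set B := basisOfOrthonormalOfCardEqFinrank hon hcard
  have hB : ⇑B = v := coe_basisOfOrthonormalOfCardEqFinrank hon hcard
  refine ⟨B.toOrthonormalBasis (hB ▸ hon), ?_, fun k => ?_⟩ <;>
  simp [Module.Basis.coe_toOrthonormalBasis, hB, hv]

theorem transversal_eq_radon (F : 𝓢(E d, E d)) (ω : S d) :
    transversal F ω = radon (component (ω : E d) F) ω := rfl

theorem radon_add (f g : 𝓢(E d, ℝ)) (ω : S d) (p : ℝ) :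
    radon (fun x => f x + g x) ω p = radon f ω p + radon g ω p :=
  integral_add (radonIntegrable_schwartz f ω p) (radonIntegrable_schwartz g ω p)

/-- The `p`-derivative of the transversal transform is the Radon transform of the divergence. -/
theorem hasDerivAt_transversal (hd : 0 < d) (F : 𝓢(E d, E d)) (ω : S d)
    {w : Fin (d - 1) → E d} (hw : Orthonormal ℝ w) (hωw : ∀ k, inner ℝ (ω : E d) (w k) = 0)
    (p : ℝ) : HasDerivAt (transversal F ω) (radon (divergence F) ω p) p := by
  obtain ⟨e, he0, hek⟩ := exists_orthonormalBasis hd ω hw hωw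
  have hdiv : divergence F = fun x => (∂_{(ω : E d)} (component (ω : E d) F) : 𝓢(E d, ℝ)) x +
      ∑ k, (∂_{w k} (component (w k) F) : 𝓢(E d, ℝ)) x := by
    ext x
    rw [divergence_eq_sum e, Fintype.sum_option]
    simp only [he0, hek, lineDeriv_component]
  have hrad : radon (divergence F) ω p =
      radon (∂_{(ω : E d)} (component (ω : E d) F) : 𝓢(E d, ℝ)) ω p := by
    rw [hdiv]
    have hi := fun k => radonIntegrable_schwartz (∂_{w k} (component (w k) F)) ω p
    refine (integral_add (radonIntegrable_schwartz _ ω p)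
      (integrable_finsetSum _ fun k _ => hi k)).trans ?_
    rw [integral_finsetSum _ fun k _ => hi k]
    refine (add_eq_left).2 (Finset.sum_eq_zero fun k _ => ?_)
    exact radon_lineDeriv_eq_zero _ ω p (hωw k)
  rw [hrad, transversal_eq_radon]
  exact hasDerivAt_radon _ ω p

/-- The vector field `x ↦ (v · x) F(x)`. -/
noncomputable def weightedField (v : E d) (F : 𝓢(E d, E d)) : 𝓢(E d, E d) :=
  SchwartzMap.smulLeftCLM (E d) (innerSL ℝ v) F

@[simp]
theorem weightedField_apply (v : E d) (F : 𝓢(E d, E d)) (x : E d) :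
    weightedField v F x = inner ℝ v x • F x :=
  SchwartzMap.smulLeftCLM_apply_apply (innerSL ℝ v).hasTemperateGrowth F x

/-- Product rule: the gradient of `x ↦ v · x` is `v`. The term `v · F` is how a tangential component
enters transversal data. -/
theorem divergence_weightedField (v : E d) (F : 𝓢(E d, E d)) (x : E d) :
    divergence (weightedField v F) x = inner ℝ v x * divergence F x + inner ℝ v (F x) := by
  have h : fderiv ℝ (weightedField v F) x =
      inner ℝ v x • fderiv ℝ F x + (innerSL ℝ v).smulRight (F x) := by
    have h1 := (innerSL ℝ v).hasFDerivAt.smul (F.hasFDerivAt x)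
    have h2 : ⇑(weightedField v F) = ⇑(innerSL ℝ v) • ⇑F := by
      ext1 y
      exact weightedField_apply v F y
    rw [h2, h1.fderiv]
    rfl
  rw [divergence, h, divergence, Finset.mul_sum, PiLp.inner_apply v (F x), ← Finset.sum_add_distrib]
  refine Finset.sum_congr rfl fun j _ => ?_
  simp [EuclideanSpace.inner_single_right, mul_comm]

/-- With the weight absorbed into the field, `hasDerivAt_transversal` applies to the weighted data.
-/
theorem weightedTransversal_eq_transversal (b : S d → Fin (d - 1) → E d) (k : Fin (d - 1))
    (F : 𝓢(E d, E d)) (ω : S d) :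
    weightedTransversal b k F ω = transversal (weightedField (b ω k) F) ω := by
  ext p
  simp only [weightedTransversal, transversal, weightedField_apply, inner_smul_right,
    real_inner_comm (ω : E d)]

/-- The scalar function `x ↦ (v · x) f(x)`. -/
noncomputable def weightedScalar (v : E d) (f : 𝓢(E d, ℝ)) : 𝓢(E d, ℝ) :=
  SchwartzMap.smulLeftCLM ℝ (innerSL ℝ v) f

theorem weightedScalar_apply (v : E d) (f : 𝓢(E d, ℝ)) (x : E d) :
    weightedScalar v f x = inner ℝ v x * f x :=
  SchwartzMap.smulLeftCLM_apply_apply (innerSL ℝ v).hasTemperateGrowth f x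

theorem coe_weightedScalar_divergence (v : E d) (F : 𝓢(E d, E d)) :
    ⇑(weightedScalar v (divergenceSchwartz F)) = fun x => inner ℝ v x * divergence F x := by
  ext x
  rw [weightedScalar_apply, coe_divergenceSchwartz]

theorem radon_divergence_weightedField (v : E d) (F : 𝓢(E d, E d)) (ω : S d) (p : ℝ) :
    radon (divergence (weightedField v F)) ω p =
      radon (fun x => inner ℝ v x * divergence F x) ω p + radon (component v F) ω p := by
  rw [← coe_weightedScalar_divergence, ← radon_add]
  congr 1
  ext x
  rw [divergence_weightedField, coe_weightedScalar_divergence, component_apply]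

theorem coe_component_single (F : 𝓢(E d, E d)) (j : Fin d) :
    ⇑(component (EuclideanSpace.single j 1) F) = fun x => F x j := by
  ext x
  simp [EuclideanSpace.inner_single_left]

/-- The Radon transform commutes with taking components. -/
theorem inner_radonVec (v : E d) (F : 𝓢(E d, E d)) (ω : S d) (p : ℝ) :
    inner ℝ v (radonVec F ω p) = radon (component v F) ω p := by
  have hi : ∀ j, Integrable fun y : Hyper ω => F (p • (ω : E d) + (y : E d)) j * v j := by
    intro j
    have := radonIntegrable_schwartz (component (EuclideanSpace.single j 1) F) ω p
    rw [coe_component_single] at this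
    exact this.mul_const _
  simp only [PiLp.inner_apply, radonVec, radon, component_apply, RCLike.inner_apply, conj_trivial]
  rw [integral_finsetSum _ fun j _ => hi j]
  simp_rw [integral_mul_const]

end VectorFields

end VectorRadon

/-! ### The reconstruction theorem -/

open VectorRadon in
theorem theorem2 (d : ℕ) (hd : 2 ≤ d)
    (F : 𝓢(EuclideanSpace ℝ (Fin d), EuclideanSpace ℝ (Fin d)))
    (b : S d → Fin (d - 1) → E d) (hb : IsAdaptedFrame b) :
    -- all the transforms of `F` that occur below exist and are differentiable in `p`
    (∀ (ω : S d) (p : ℝ),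
      (∀ j, RadonIntegrable (fun x => F x j) ω p) ∧
      RadonIntegrable (fun x => inner ℝ (ω : E d) (F x)) ω p ∧
      DifferentiableAt ℝ (transversal F ω) p ∧
      ∀ k, RadonIntegrable (fun x => inner ℝ (b ω k) x * inner ℝ (F x) (ω : E d)) ω p ∧
        DifferentiableAt ℝ (weightedTransversal b k F ω) p ∧
        RadonIntegrable (fun x => inner ℝ (b ω k) x * divergence F x) ω p) ∧
    -- reconstruction of the divergence
    (∀ α : ℝ, α < d →
      InvRadonDefined α (fun (ω : S d) p => ((deriv (transversal F ω) p : ℝ) : ℂ)) ∧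
      ∀ x, (divergence F x : ℂ) =
        invRadon α (fun (ω : S d) p => ((deriv (transversal F ω) p : ℝ) : ℂ)) x) ∧
    -- reconstruction of the componentwise Radon transform
    (∀ (ω : S d) (p : ℝ),
      radonVec F ω p = transversal F ω p • (ω : E d) +
        ∑ k : Fin (d - 1),
          (deriv (weightedTransversal b k F ω) p -
            radon (fun x => inner ℝ (b ω k) x * divergence F x) ω p) • b ω k) ∧
    -- reconstruction of the field
    (∀ α : ℝ, α < d → ∀ j : Fin d,
      InvRadonDefined α
        (fun (ω : S d) p => ((inner ℝ (EuclideanSpace.single j 1) (radonVec F ω p) : ℝ) : ℂ)) ∧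
      ∀ x, ((F x j : ℝ) : ℂ) = invRadon α
        (fun (ω : S d) p => ((inner ℝ (EuclideanSpace.single j 1) (radonVec F ω p) : ℝ) : ℂ)) x) := by
  have hd0 : 0 < d := by omega
  have htrans := fun (ω : S d) (G : 𝓢(E d, E d)) (p : ℝ) =>
    hasDerivAt_transversal hd0 G ω (hb ω).1 (hb ω).2 p
  have hweight : ∀ (ω : S d) (k : Fin (d - 1)) (p : ℝ),
      HasDerivAt (weightedTransversal b k F ω)
        (radon (fun x => inner ℝ (b ω k) x * divergence F x) ω p +
          radon (component (b ω k) F) ω p) p := by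
    intro ω k p
    rw [weightedTransversal_eq_transversal, ← radon_divergence_weightedField]
    exact htrans ω (weightedField (b ω k) F) p
  refine ⟨fun ω p => ⟨fun j => ?_, radonIntegrable_schwartz (component (ω : E d) F) ω p,
    (htrans ω F p).differentiableAt, fun k => ⟨?_, (hweight ω k p).differentiableAt, ?_⟩⟩,
    fun α hα => ?_, fun ω p => ?_, fun α hα j => ?_⟩
  · rw [← coe_component_single]
    exact radonIntegrable_schwartz _ ω p
  · have h := radonIntegrable_schwartz (component (ω : E d) (weightedField (b ω k) F)) ω p
    convert! h using 2 with x
    rw [component_apply, weightedField_apply, inner_smul_right, real_inner_comm (F x)]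
  · rw [← coe_weightedScalar_divergence]
    exact radonIntegrable_schwartz _ ω p
  · have hg : (fun (ω : S d) p => ((deriv (transversal F ω) p : ℝ) : ℂ)) =
        fun (ω : S d) p => (radon (divergenceSchwartz F) ω p : ℂ) := by
      ext ω p
      rw [(htrans ω F p).deriv, coe_divergenceSchwartz]
    rw [hg, ← coe_divergenceSchwartz]
    exact invRadon_radon hd0 hα _
  · obtain ⟨e, he0, hek⟩ := exists_orthonormalBasis hd0 ω (hb ω).1 (hb ω).2
    -- The coefficient along `ω` is the transversal transform; `hweight` supplies the tangential
    -- ones after the divergence term cancels.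
    rw [← e.sum_repr' (radonVec F ω p), Fintype.sum_option, he0]
    simp only [hek, inner_radonVec, (hweight ω _ p).deriv, add_sub_cancel_left]
    rfl
  · have hg : (fun (ω : S d) p =>
        ((inner ℝ (EuclideanSpace.single j 1) (radonVec F ω p) : ℝ) : ℂ)) =
        fun (ω : S d) p => (radon (component (EuclideanSpace.single j 1) F) ω p : ℂ) := by
      ext ω p
      rw [inner_radonVec]
    rw [hg]
    have h := invRadon_radon hd0 hα (component (EuclideanSpace.single j 1) F)
    refine ⟨h.1, fun x => ?_⟩
    rw [← h.2 x, coe_component_single]
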